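/- **Theorem (Stability of OIT-inspired filtering).** Consider the linear system with uncertain variables $$\mathbf{x}_{k+1}=A\mathbf{x}_k+B\mathbf{w}_k,\qquad \mathbf{y}_k=C\mathbf{x}_k+\mathbf{v}_k,\qquad k\in\mathbb{N}_0,$$ where $A\in\mathbb{R}^{n\times n}$ is nonsingular, $B\in\mathbb{R}^{n\times p}$, $C\in\mathbb{R}^{m\times n}$, and $\mathbf{x}_0,\mathbf{w}_k,\mathbf{v}_k$ are maps on a common sample space $\Omega$ with ranges (images) $[\![\mathbf{x}_0]\!],[\![\mathbf{w}_k]\!],[\![\mathbf{v}_k]\!]$. The true initial range $[\![\mathbf{x}_0]\!]$ is bounded, and there are constants $d_w,d_v>0$ that bound the diameters of $[\![\mathbf{w}_k]\!]$ and of $[\![\mathbf{v}_k]\!]$, respectively, for all $k$. ($\mathbf{x}_0$, the $\mathbf{w}_k$ and the $\mathbf{v}_k$ may be unrelated, i.e. of joint range equal to the product of their ranges, but this is not required.) Let $y_0,y_1,\dots$ be observed measurements: for every $k$ some $\omega\in\Omega$ satisfies $\mathbf{y}_i(\omega)=y_i$ for all $i\le k$. The true conditional range $[\![\mathbf{x}_k|y_{0:k}]\!]$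 is the set of all $\mathbf{x}_k(\omega)$ with $\mathbf{y}_i(\omega)=y_i$ for all $i\le k$. *Filtering map.* Let $\mathcal{X}_k=\{x: y_k=Cx+v \text{ for some } v\in[\![\mathbf{v}_k]\!]\}$, $f_k(\mathcal{S})=\mathcal{X}_k\cap(A\mathcal{S}+B[\![\mathbf{w}_{k-1}]\!])$ for $k\ge1$, $F_{0,0}(\mathcal{S})=\mathcal{X}_0\cap\mathcal{S}$ and $F_{k,0}(\mathcal{S})=f_k(F_{k-1,0}(\mathcal{S}))$. *Observability decomposition.* Let $P$ be nonsingular with $PAP^{-1}=\begin{bmatrix}\tilde A_o&0\\ \tilde A_{21}&\tilde A_{\bar o}\end{bmatrix}$ and $CP^{-1}=[\tilde C_o\ 0]$, where $\tilde A_o\in\mathbb{R}^{n_o\times n_o}$, $\tilde A_{\bar o}\in\mathbb{R}^{n_{\bar o}\times n_{\bar o}}$ and $(\tilde A_o,\tilde C_o)$ is observable; its observability index $\mu_o$ is the least $N$ such that the matrix with block rows $\tilde C_o,\tilde C_o\tilde A_o,\dots,\tilde C_o\tilde A_o^{N-1}$ has rank $n_o$. *OIT-inspired filtering.* Let the initial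 condition $[\![\hat{\mathbf{x}}_0]\!]\subset\mathbb{R}^n$ be non-empty and bounded, and let $\hat{\mathcal{S}}^{\bar o}_0\subset\mathbb{R}^{n_{\bar o}}$ be the projection of $P[\![\hat{\mathbf{x}}_0]\!]$ to the last $n_{\bar o}$ coordinates. The estimates $\mathcal{Z}_k$ are as follows. - For $k<\mu_o-1$, $\mathcal{Z}_k$ is the estimate of the classical filter if that is non-empty. If it is empty, $\mathcal{Z}_k$ is reset: one chooses any $\hat{\mathcal{T}}^o_0\subseteq\mathbb{R}^{n_o}$ for which $\mathcal{Z}_k=F_{k,0}\big(P^{-1}(\hat{\mathcal{T}}^o_0\times\hat{\mathcal{S}}^{\bar o}_0)\big)$ is non-empty and bounded. The estimate of the classical filter at time $k$ may be understood, throughout, either as $F_{k,0}([\![\hat{\mathbf{x}}_0]\!])$, or as $\mathcal{X}_0\cap[\![\hat{\mathbf{x}}_0]\!]$ for $k=0$ and $f_k(\mathcal{Z}_{k-1})$ for $k\ge1$. - For $k\ge\mu_o-1$, $\mathcal{Z}_k=F_{k,0}\big(P^{-1}(\mathbb{R}^{n_o}\times\hat{\mathcal{S}}^{\bar o}_0)\big)$.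 If $(A,C)$ is detectable, i.e. $A^kx\to0$ for every $x$ with $CA^kx=0$ for all $k\in\mathbb{N}_0$, then the OIT-inspired filtering framework can be executed (suitable resets exist whenever they are needed) and, for every choice of the resets, it is stable: $\mathcal{Z}_k\ne\emptyset$ for all $k\in\mathbb{N}_0$, and there is a $\bar d>0$ such that the Hausdorff distance satisfies $d_{\mathrm H}(\mathcal{Z}_k,[\![\mathbf{x}_k|y_{0:k}]\!])\le\bar d$ for all $k\in\mathbb{N}_0$. -/

import Mathlib

open scoped Matrix Pointwise

noncomputable section

/-- Euclidean space `ℝ^d`. -/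
abbrev Euc (d : ℕ) : Type := EuclideanSpace ℝ (Fin d)

/-- A linear system `x_{k+1} = A x_k + B w_k`, `y_k = C x_k + v_k` driven by uncertain variables,
i.e. by arbitrary maps on a common sample space `Ω`; no relation between `x0`, the `w k` and the
`v k` is imposed. -/
structure UncertainSystem (Ω : Type*) (n p m : ℕ) where
  /-- state matrix -/
  A : Matrix (Fin n) (Fin n) ℝ
  /-- process noise matrix -/
  B : Matrix (Fin n) (Fin p) ℝ
  /-- measurement matrix -/
  C : Matrix (Fin m) (Fin n) ℝ
  /-- initial state -/
  x0 : Ω → Euc n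
  /-- process noise -/
  w : ℕ → Ω → Euc p
  /-- measurement noise -/
  v : ℕ → Ω → Euc m

namespace UncertainSystem

variable {Ω : Type*} {n p m : ℕ} (S : UncertainSystem Ω n p m)

/-- The state `x_k` as an uncertain variable. -/
def state : ℕ → Ω → Euc n
  | 0, ω => S.x0 ω
  | k + 1, ω => S.A.toEuclideanLin (state k ω) + S.B.toEuclideanLin (S.w k ω)

/-- The measurement `y_k` as an uncertain variable. -/
def meas (k : ℕ) (ω : Ω) : Euc m :=
  S.C.toEuclideanLin (S.state k ω) + S.v k ω

/-- `y_{0:k}` is a realization of the measurements up to time `k`, for every `k`. -/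
def IsObserved (y : ℕ → Euc m) : Prop :=
  ∀ k, ∃ ω, ∀ i ≤ k, S.meas i ω = y i

/-- The true conditional range `⟦x_k | y_{0:k}⟧`: all values that the state can take at time `k`
when the measurements up to time `k` are `y_0, …, y_k`. -/
def condRange (y : ℕ → Euc m) (k : ℕ) : Set (Euc n) :=
  {x | ∃ ω, (∀ i ≤ k, S.meas i ω = y i) ∧ S.state k ω = x}

/-- The set `𝒳_k(C, y_k, ⟦v_k⟧)` of states compatible with the measurement at time `k`. -/
def measSet (y : ℕ → Euc m) (k : ℕ) : Set (Euc n) :=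
  {x | ∃ u ∈ Set.range (S.v k), y k = S.C.toEuclideanLin x + u}

/-- The prediction-update map from time `k` to time `k + 1`:
`T ↦ 𝒳_{k+1}(C, y_{k+1}, ⟦v_{k+1}⟧) ∩ (A T + B ⟦w_k⟧)`. -/
def predUpdate (y : ℕ → Euc m) (k : ℕ) (T : Set (Euc n)) : Set (Euc n) :=
  S.measSet y (k + 1) ∩
    (S.A.toEuclideanLin '' T + S.B.toEuclideanLin '' Set.range (S.w k))

/-- The filtering map `F_{k,0}`; the classical set-membership filter with initial condition `T`
returns `F_{k,0}(T)` at time `k`. -/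
def filteringMap (y : ℕ → Euc m) : ℕ → Set (Euc n) → Set (Euc n)
  | 0, T => S.measSet y 0 ∩ T
  | k + 1, T => S.predUpdate y k (filteringMap y k T)

/-- A filter with estimates `Z k` is stable along the measurements `y`: it is well-posed, and its
estimation gap, the Hausdorff distance to the true conditional range, is bounded. -/
def IsStable (y : ℕ → Euc m) (Z : ℕ → Set (Euc n)) : Prop :=
  (∀ k, (Z k).Nonempty) ∧
    ∃ d : ℝ, 0 < d ∧ ∀ k, Metric.hausdorffEDist (Z k) (S.condRange y k) ≤ ENNReal.ofReal d

end UncertainSystem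

/-- The observability matrix with block rows `C, C A, …, C A^(N-1)`. -/
def obsMatrix {n m : ℕ} (A : Matrix (Fin n) (Fin n) ℝ) (C : Matrix (Fin m) (Fin n) ℝ) (N : ℕ) :
    Matrix (Fin N × Fin m) (Fin n) ℝ :=
  Matrix.of fun r c => (C * A ^ (r.1 : ℕ)) r.2 c

/-- Observability of the pair `(A, C)`: the rank condition on the observability matrix. -/
def IsObservable {n m : ℕ} (A : Matrix (Fin n) (Fin n) ℝ) (C : Matrix (Fin m) (Fin n) ℝ) : Prop :=
  (obsMatrix A C n).rank = n

/-- The observability index of an observable pair: the least `N` for which the matrix with block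
rows `C, C A, …, C A^(N-1)` has full column rank. -/
def obsIndex {n m : ℕ} (A : Matrix (Fin n) (Fin n) ℝ) (C : Matrix (Fin m) (Fin n) ℝ) : ℕ :=
  sInf {N | (obsMatrix A C N).rank = n}

/-- Detectability of the pair `(A, C)`: all unobservable states are (asymptotically) stable. -/
def IsDetectable {n m : ℕ} (A : Matrix (Fin n) (Fin n) ℝ) (C : Matrix (Fin m) (Fin n) ℝ) : Prop :=
  ∀ x : Euc n, (∀ k : ℕ, (C * A ^ k).toEuclideanLin x = 0) →
    Filter.Tendsto (fun k : ℕ => (A ^ k).toEuclideanLin x) Filter.atTop (nhds 0)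

/-- An observability decomposition of `(A, C)`: a nonsingular `P` (with inverse `Pinv`) such that
`P A P⁻¹ = [Ao 0; A21 Au]`, `C P⁻¹ = [Co 0]` and `(Ao, Co)` is observable. -/
structure ObsDecomposition {n m : ℕ} (A : Matrix (Fin n) (Fin n) ℝ)
    (C : Matrix (Fin m) (Fin n) ℝ) (no nu : ℕ) where
  /-- the transformation -/
  P : Matrix (Fin no ⊕ Fin nu) (Fin n) ℝ
  /-- its inverse -/
  Pinv : Matrix (Fin n) (Fin no ⊕ Fin nu) ℝ
  /-- state matrix of the observable subsystem -/
  Ao : Matrix (Fin no) (Fin no) ℝ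
  /-- coupling block -/
  A21 : Matrix (Fin nu) (Fin no) ℝ
  /-- state matrix of the unobservable subsystem -/
  Au : Matrix (Fin nu) (Fin nu) ℝ
  /-- measurement matrix of the observable subsystem -/
  Co : Matrix (Fin m) (Fin no) ℝ
  P_mul_Pinv : P * Pinv = 1
  Pinv_mul_P : Pinv * P = 1
  A_eq : P * A * Pinv = Matrix.fromBlocks Ao 0 A21 Au
  C_eq : C * Pinv = Matrix.fromCols Co 0
  observable : IsObservable Ao Co

namespace ObsDecomposition

variable {n m no nu : ℕ} {A : Matrix (Fin n) (Fin n) ℝ} {C : Matrix (Fin m) (Fin n) ℝ}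
  (D : ObsDecomposition A C no nu)

/-- The observability index `μ_o` of the observable subsystem. -/
def index : ℕ := obsIndex D.Ao D.Co

/-- The projection of `P T` to the coordinates of the unobservable subsystem. -/
def projUnobs (T : Set (Euc n)) : Set (Euc nu) :=
  (fun x => D.P.toRows₂.toEuclideanLin x) '' T

/-- The set `P⁻¹ (To × Tu)`. -/
def pullProd (To : Set (Euc no)) (Tu : Set (Euc nu)) : Set (Euc n) :=
  {x | ∃ a ∈ To, ∃ b ∈ Tu,
    x = D.Pinv.toEuclideanLin (WithLp.toLp 2 (Sum.elim a.ofLp b.ofLp))}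

end ObsDecomposition

/-- The two ways to run the classical filter at the early times, where estimates may be reset:
either it is the classical filter started at the initial condition, or it is one
prediction-update step from the current (possibly reset) estimate of the previous time. -/
inductive EarlyMode
  | fromInitial
  | fromPrevious

namespace UncertainSystem

variable {Ω : Type*} {n p m no nu : ℕ} (S : UncertainSystem Ω n p m)

/-- The classical estimate at time `k`, before a possible reset, when the estimates at the
earlier times are given by `Z`. -/
def classicalEstimate (y : ℕ → Euc m) (X0 : Set (Euc n)) (Z : ℕ → Set (Euc n)) :
    EarlyMode → ℕ → Set (Euc n)
  | .fromInitial, k => S.filteringMap y k X0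
  | .fromPrevious, 0 => S.measSet y 0 ∩ X0
  | .fromPrevious, k + 1 => S.predUpdate y k (Z k)

/-- `Z` is a sequence of estimates returned by OIT-inspired filtering with initial condition `X0`
along the measurements `y`. For `k < μ_o - 1` (written without subtraction) it is the classical
estimate, reset to some non-empty bounded `F_{k,0}(P⁻¹ (To × projUnobs X0))` if that is empty;
for `k ≥ μ_o - 1` it is `F_{k,0}(P⁻¹ (ℝ^no × projUnobs X0))`. -/
structure IsOITRun (D : ObsDecomposition S.A S.C no nu) (mode : EarlyMode)
    (X0 : Set (Euc n)) (y : ℕ → Euc m) (Z : ℕ → Set (Euc n)) : Prop where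
  early_keep : ∀ k, k + 1 < D.index →
    (S.classicalEstimate y X0 Z mode k).Nonempty → Z k = S.classicalEstimate y X0 Z mode k
  early_reset : ∀ k, k + 1 < D.index →
    S.classicalEstimate y X0 Z mode k = ∅ →
      (∃ To : Set (Euc no), Z k = S.filteringMap y k (D.pullProd To (D.projUnobs X0))) ∧
        (Z k).Nonempty ∧ Bornology.IsBounded (Z k)
  late : ∀ k, D.index ≤ k + 1 →
    Z k = S.filteringMap y k (D.pullProd Set.univ (D.projUnobs X0))

end UncertainSystem

end

/-! Two state trajectories that explain the same measurements differ by a sequence `e` whose defects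
`e (i + 1) - A (e i)` and outputs `C (e i)` are differences of noise values, hence bounded by the
noise diameters (`exists_trajectory_difference_bound`). Observability recovers the observable
coordinates of `e` from any window of `μ_o` outputs. The unobservable coordinates follow a recursion
that detectability makes stable, driven by the bounded observable ones and started from a bounded
set. So `e k` is bounded uniformly in `k ≥ μ_o - 1`, whatever the initial observable coordinates
(`exists_bound_of_detectable`): every estimated state is close to a true one.

Conversely, replacing the unobservable initial coordinates of a true trajectory by admissible ones
changes neither the outputs nor the noise (`add_mem_filteringMap_pullProd`), and the resulting shift
stays bounded. The same shift yields non-emptiness and the resets. Only finitely many earlier times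
remain; there both sets are non-empty and bounded. -/

section LinearRecursions

/-! ### Perturbed linear recursions in finite dimension -/

variable {E F : Type*} [NormedAddCommGroup E] [NormedSpace ℝ E] [FiniteDimensional ℝ E]
  [NormedAddCommGroup F] [NormedSpace ℝ F]

lemma LinearMap.exists_norm_le_mul (T : E →ₗ[ℝ] F) : ∃ K : ℝ, 0 ≤ K ∧ ∀ x, ‖T x‖ ≤ K * ‖x‖ :=
  ⟨‖T.toContinuousLinearMap‖, norm_nonneg _, fun x => T.toContinuousLinearMap.le_opNorm x⟩

lemma LinearMap.isBounded_image (T : E →ₗ[ℝ] F) {s : Set E} (hs : Bornology.IsBounded s) :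
    Bornology.IsBounded (T '' s) :=
  T.toContinuousLinearMap.lipschitz.isBounded_image hs

/-- Over `j` steps, a perturbed orbit of a linear map departs from the unperturbed one by at most
a fixed multiple of the bound on the perturbations. -/
lemma LinearMap.exists_perturbed_orbit_bound (T : E →ₗ[ℝ] E) :
    ∃ s : ℕ → ℝ, (∀ j, 0 ≤ s j) ∧ ∀ (c : ℝ) (u : ℕ → E) (i j : ℕ),
      (∀ l < i + j, ‖u (l + 1) - T (u l)‖ ≤ c) → ‖u (i + j) - (T ^ j) (u i)‖ ≤ s j * c := by
  obtain ⟨K, hK, hT⟩ := T.exists_norm_le_mul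
  -- `s (j + 1) = 1 + K * s j`: one new defect, plus the old error amplified by `T`.
  refine ⟨fun j => Nat.rec 0 (fun _ r => 1 + K * r) j, fun j => ?_, fun c u i j => ?_⟩
  · induction j with
    | zero => simp
    | succ j ih => dsimp only at ih ⊢; positivity
  · induction j with
    | zero => simp
    | succ j ih =>
      intro h
      have h1 := ih fun l hl => h l (by omega)
      have h2 := h (i + j) (by omega)
      have h3 := (hT (u (i + j) - (T ^ j) (u i))).trans (mul_le_mul_of_nonneg_left h1 hK)
      have e : u (i + (j + 1)) - (T ^ (j + 1)) (u i)
          = (u (i + j + 1) - T (u (i + j))) + T (u (i + j) - (T ^ j) (u i)) := by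
        rw [pow_succ', Module.End.mul_apply, map_sub, ← add_assoc]; abel
      rw [e]
      refine (norm_add_le _ _).trans ((add_le_add h2 h3).trans (le_of_eq ?_))
      ring

/-- In finite dimension the operator norm is controlled by the values on a basis, so pointwise decay
makes some power a contraction. -/
lemma LinearMap.exists_pow_contracting (T : E →ₗ[ℝ] E)
    (hT : ∀ x, Filter.Tendsto (fun k : ℕ => (T ^ k) x) Filter.atTop (nhds 0)) :
    ∃ N : ℕ, 0 < N ∧ ∀ x, ‖(T ^ N) x‖ ≤ 1 / 2 * ‖x‖ := by
  obtain ⟨K, hK, hb⟩ :=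
    (Module.finBasis ℝ E).exists_opNorm_le (F := E)
  have h : ∀ᶠ k : ℕ in Filter.atTop, ∀ i,
      ‖(T ^ k) (Module.finBasis ℝ E i)‖ ≤ 1 / 2 / K := by
    refine Filter.eventually_all.2 fun i => ?_
    have := (hT (Module.finBasis ℝ E i)).norm
    rw [norm_zero] at this
    exact (this.eventually_lt_const (by positivity)).mono fun _ h => h.le
  obtain ⟨N, hN, hpos⟩ := (h.and (Filter.eventually_gt_atTop 0)).exists
  refine ⟨N, hpos, fun x => ?_⟩
  have h1 := hb (u := (T ^ N).toContinuousLinearMap) (M := 1 / 2 / K) (by positivity) hN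
  rw [mul_div_cancel₀ _ hK.ne'] at h1
  exact (T ^ N).toContinuousLinearMap.le_of_opNorm_le h1 x

/-- Bounded perturbations of a stable linear recursion produce bounded states. -/
lemma LinearMap.exists_bound_of_tendsto_pow (T : E →ₗ[ℝ] E)
    (hT : ∀ x, Filter.Tendsto (fun k : ℕ => (T ^ k) x) Filter.atTop (nhds 0)) (c : ℝ) :
    ∃ M : ℝ, ∀ (u : ℕ → E) (k : ℕ), ‖u 0‖ ≤ c → (∀ i < k, ‖u (i + 1) - T (u i)‖ ≤ c) →
      ‖u k‖ ≤ M := by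
  obtain ⟨N, hN, hc⟩ := T.exists_pow_contracting hT
  obtain ⟨s, hs, hu⟩ := T.exists_perturbed_orbit_bound
  choose K hK hTK using fun j : ℕ => (T ^ j).exists_norm_le_mul
  by_cases c0 : 0 ≤ c
  swap
  · exact ⟨0, fun u k h => absurd ((norm_nonneg _).trans h) c0⟩
  -- `2 * (s N * c)` is the fixed point of `r ↦ r / 2 + s N * c`; the extra `c` covers the initial
  -- value.
  set R : ℝ := c + 2 * (s N * c) with hR
  have hsN := mul_nonneg (hs N) c0
  have key : ∀ (u : ℕ → E) (q : ℕ), ‖u 0‖ ≤ c →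
      (∀ i < N * q, ‖u (i + 1) - T (u i)‖ ≤ c) → ‖u (N * q)‖ ≤ R := by
    intro u q h0
    induction q with
    | zero => intro _; simp only [mul_zero]; linarith
    | succ q ih =>
      intro h
      have h1 := ih fun i hi => h i (hi.trans_le (Nat.mul_le_mul_left _ q.le_succ))
      have h2 := hu c u (N * q) N fun l hl => h l (by rwa [Nat.mul_succ])
      have h3 := hc (u (N * q))
      have h4 := norm_sub_norm_le (u (N * q + N)) ((T ^ N) (u (N * q)))
      rw [Nat.mul_succ]
      linarith
  have hR0 : 0 ≤ R := by positivity
  -- The sum stands in for the maximum over the remainders of `k` modulo `N`.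
  refine ⟨∑ r ∈ Finset.range N, (K r * R + s r * c), fun u k h0 h => ?_⟩
  have h1 := key u (k / N) h0 fun i hi => h i (hi.trans_le (Nat.mul_div_le k N))
  have h2 := hu c u (N * (k / N)) (k % N) fun l hl => h l (by rwa [Nat.div_add_mod] at hl)
  rw [Nat.div_add_mod] at h2
  have h3 := (hTK (k % N) (u (N * (k / N)))).trans (mul_le_mul_of_nonneg_left h1 (hK _))
  have h4 := norm_sub_norm_le (u k) ((T ^ (k % N)) (u (N * (k / N))))
  have h5 := Finset.single_le_sum (f := fun r => K r * R + s r * c)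
    (fun r _ => add_nonneg (mul_nonneg (hK r) hR0) (mul_nonneg (hs r) c0))
    (Finset.mem_range.2 (Nat.mod_lt k hN))
  linarith

/-- The stacked output map is injective on a finite-dimensional space, hence bounded below. -/
lemma LinearMap.exists_bound_of_observable (T : E →ₗ[ℝ] E) (C : E →ₗ[ℝ] F) (N : ℕ)
    (h : ∀ x, (∀ r < N, C ((T ^ r) x) = 0) → x = 0) :
    ∃ K : ℝ, 0 ≤ K ∧ ∀ (x : E) (b : ℝ), 0 ≤ b → (∀ r < N, ‖C ((T ^ r) x)‖ ≤ b) → ‖x‖ ≤ K * b := by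
  let O : E →ₗ[ℝ] (Fin N → F) := LinearMap.pi fun r => C ∘ₗ (T ^ (r : ℕ))
  have hO : LinearMap.ker O = ⊥ := by
    refine LinearMap.ker_eq_bot'.2 fun x hx => h x fun r hr => ?_
    exact congrFun hx ⟨r, hr⟩
  obtain ⟨K, -, hK⟩ := O.exists_antilipschitzWith hO
  refine ⟨K, K.2, fun x b hb hx => ?_⟩
  have h1 := hK.le_mul_dist x 0
  rw [map_zero, dist_zero_right, dist_zero_right] at h1
  refine h1.trans (mul_le_mul_of_nonneg_left ?_ K.2)
  exact (pi_norm_le_iff_of_nonneg hb).2 fun r => hx r r.2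

/-- Over a horizon at least as long as the observability index, bounded perturbations and bounded
outputs imply bounded states, uniformly in the horizon. -/
lemma LinearMap.exists_bound_of_bounded_outputs (T : E →ₗ[ℝ] E) (C : E →ₗ[ℝ] F) (N : ℕ)
    (h : ∀ x, (∀ r < N, C ((T ^ r) x) = 0) → x = 0) (c : ℝ) :
    ∃ M : ℝ, ∀ (e : ℕ → E) (k : ℕ), N ≤ k + 1 → (∀ i < k, ‖e (i + 1) - T (e i)‖ ≤ c) →
      (∀ i ≤ k, ‖C (e i)‖ ≤ c) → ∀ i ≤ k, ‖e i‖ ≤ M := by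
  obtain ⟨s, hs, hu⟩ := T.exists_perturbed_orbit_bound
  obtain ⟨K, hK, hobs⟩ := T.exists_bound_of_observable C N h
  obtain ⟨KC, hKC, hC⟩ := C.exists_norm_le_mul
  choose L hL hTL using fun j : ℕ => (T ^ j).exists_norm_le_mul
  by_cases c0 : 0 ≤ c
  swap
  · exact ⟨0, fun e k _ _ h => absurd ((norm_nonneg _).trans (h 0 k.zero_le)) c0⟩
  set G : ℝ := ∑ r ∈ Finset.range N, s r
  have hG0 : 0 ≤ G := Finset.sum_nonneg fun r _ => hs r
  have hG : ∀ r < N, s r ≤ G := fun r hr =>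
    Finset.single_le_sum (fun r _ => hs r) (Finset.mem_range.2 hr)
  set H : ℝ := ∑ r ∈ Finset.range N, L r
  have hH0 : 0 ≤ H := Finset.sum_nonneg fun r _ => hL r
  have hH : ∀ r < N, L r ≤ H := fun r hr =>
    Finset.single_le_sum (fun r _ => hL r) (Finset.mem_range.2 hr)
  set M : ℝ := K * (c + KC * (G * c))
  have hM0 : 0 ≤ M := by positivity
  refine ⟨M + (H * M + G * c), fun e k hk he hCe => ?_⟩
  -- The output window `j, …, j + N - 1` fits into the horizon. There `C (T ^ r (e j))` differs from
  -- the output `C (e (j + r))` by at most `KC * (G * c)`.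
  have key : ∀ j, j + N ≤ k + 1 → ‖e j‖ ≤ M := by
    intro j hj
    refine hobs _ _ (by positivity) fun r hr => ?_
    have h1 := hu c e j r fun l hl => he l (by omega)
    have h2 := (hC (e (j + r) - (T ^ r) (e j))).trans
      (mul_le_mul_of_nonneg_left (h1.trans (mul_le_mul_of_nonneg_right (hG r hr) c0)) hKC)
    rw [map_sub, norm_sub_rev] at h2
    have h3 := norm_sub_norm_le (C ((T ^ r) (e j))) (C (e (j + r)))
    have h4 := hCe (j + r) (by omega)
    linarith
  intro i hi
  by_cases hiN : i + N ≤ k + 1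
  · have := key i hiN
    have h2 : 0 ≤ H * M + G * c := by positivity
    linarith
  -- For the last `N - 1` indices the window overruns the horizon; they are reached in fewer than
  -- `N` steps from the start of the last full window.
  · obtain ⟨r, hr⟩ : ∃ r, i = (k + 1 - N) + r := ⟨i - (k + 1 - N), by omega⟩
    have hrN : r < N := by omega
    have h1 := hu c e (k + 1 - N) r fun l hl => he l (by omega)
    have h2 := key (k + 1 - N) (by omega)
    have h3 := (hTL r (e (k + 1 - N))).trans (mul_le_mul (hH r hrN) h2 (norm_nonneg _) hH0)
    have h4 := norm_sub_norm_le (e i) ((T ^ r) (e (k + 1 - N)))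
    have h5 := mul_le_mul_of_nonneg_right (hG r hrN) c0
    rw [← hr] at h1
    linarith

end LinearRecursions

/-! ### Observability decomposition and detectability -/

lemma obsMatrix_eq_zero_of_rank {n m : ℕ} {A : Matrix (Fin n) (Fin n) ℝ}
    {C : Matrix (Fin m) (Fin n) ℝ} {N : ℕ} (h : (obsMatrix A C N).rank = n) (x : Euc n)
    (hx : ∀ r < N, C.toEuclideanLin ((A.toEuclideanLin ^ r) x) = 0) : x = 0 := by
  have hker : LinearMap.ker (obsMatrix A C N).mulVecLin = ⊥ := by
    have h1 := (obsMatrix A C N).mulVecLin.finrank_range_add_finrank_ker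
    rw [← Matrix.rank, h, Module.finrank_fin_fun] at h1
    exact Submodule.finrank_eq_zero.1 (by omega)
  have h2 : (obsMatrix A C N).mulVecLin x.ofLp = 0 := by
    ext ⟨r, i⟩
    have h3 := hx r r.2
    rw [← Matrix.toLpLin_pow, ← LinearMap.comp_apply, ← Matrix.toLpLin_mul] at h3
    exact congrFun (congrArg WithLp.ofLp h3) i
  have h4 := LinearMap.ker_eq_bot'.1 hker _ h2
  ext i
  exact congrFun h4 i

namespace ObsDecomposition

variable {n m no nu : ℕ} {A : Matrix (Fin n) (Fin n) ℝ} {C : Matrix (Fin m) (Fin n) ℝ}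
  (D : ObsDecomposition A C no nu)

lemma eq_zero_of_outputs_eq_zero (x : Euc no)
    (hx : ∀ r < D.index, D.Co.toEuclideanLin ((D.Ao.toEuclideanLin ^ r) x) = 0) : x = 0 :=
  -- Observability puts `no` into the set of admissible horizons, so the infimum defining the index
  -- is attained.
  obsMatrix_eq_zero_of_rank (Nat.sInf_mem (s := {N | (obsMatrix D.Ao D.Co N).rank = no})
    ⟨no, D.observable⟩) x hx

/-- The observable coordinates of a state. -/
noncomputable def obsProj : Euc n →ₗ[ℝ] Euc no := D.P.toRows₁.toEuclideanLin

/-- The unobservable coordinates of a state. -/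
noncomputable def unobsProj : Euc n →ₗ[ℝ] Euc nu := D.P.toRows₂.toEuclideanLin

/-- The state with given observable coordinates and vanishing unobservable coordinates. -/
noncomputable def obsIncl : Euc no →ₗ[ℝ] Euc n := D.Pinv.toCols₁.toEuclideanLin

/-- The state with given unobservable coordinates and vanishing observable coordinates. -/
noncomputable def unobsIncl : Euc nu →ₗ[ℝ] Euc n := D.Pinv.toCols₂.toEuclideanLin

lemma obsIncl_add_unobsIncl (a : Euc no) (b : Euc nu) :
    D.obsIncl a + D.unobsIncl b
      = D.Pinv.toEuclideanLin (WithLp.toLp 2 (Sum.elim a.ofLp b.ofLp)) := by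
  ext i
  simp [obsIncl, unobsIncl, Matrix.toLpLin_apply, Matrix.mulVec, dotProduct]

lemma incl_proj (x : Euc n) : D.obsIncl (D.obsProj x) + D.unobsIncl (D.unobsProj x) = x := by
  have h : D.Pinv.toCols₁ * D.P.toRows₁ + D.Pinv.toCols₂ * D.P.toRows₂ = 1 := by
    rw [← Matrix.fromCols_mul_fromRows, Matrix.fromCols_toCols, Matrix.fromRows_toRows,
      D.Pinv_mul_P]
  have h2 := congrArg (fun M : Matrix (Fin n) (Fin n) ℝ => M.toEuclideanLin x) h
  simpa [obsIncl, obsProj, unobsIncl, unobsProj] using h2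

lemma proj_incl_matrices :
    D.P.toRows₁ * D.Pinv.toCols₁ = 1 ∧ D.P.toRows₁ * D.Pinv.toCols₂ = 0 ∧
      D.P.toRows₂ * D.Pinv.toCols₁ = 0 ∧ D.P.toRows₂ * D.Pinv.toCols₂ = 1 := by
  have h := D.P_mul_Pinv
  rw [← Matrix.fromRows_toRows D.P, ← Matrix.fromCols_toCols D.Pinv,
    Matrix.fromRows_mul_fromCols, ← Matrix.fromBlocks_one, Matrix.fromBlocks_inj] at h
  exact h

lemma unobsProj_unobsIncl (b : Euc nu) : D.unobsProj (D.unobsIncl b) = b := by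
  have h2 := congrArg (fun M : Matrix (Fin nu) (Fin nu) ℝ => M.toEuclideanLin b)
    D.proj_incl_matrices.2.2.2
  simpa [unobsIncl, unobsProj] using h2

lemma obsProj_unobsIncl (b : Euc nu) : D.obsProj (D.unobsIncl b) = 0 := by
  have h2 := congrArg (fun M : Matrix (Fin no) (Fin nu) ℝ => M.toEuclideanLin b)
    D.proj_incl_matrices.2.1
  simpa [unobsIncl, obsProj] using h2

lemma proj_mul_matrices :
    D.P.toRows₁ * A = D.Ao * D.P.toRows₁ ∧
      D.P.toRows₂ * A = D.A21 * D.P.toRows₁ + D.Au * D.P.toRows₂ := by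
  have h : D.P * A = Matrix.fromBlocks D.Ao 0 D.A21 D.Au * D.P := by
    rw [← D.A_eq, Matrix.mul_assoc, D.Pinv_mul_P, Matrix.mul_one]
  rw [← Matrix.fromRows_toRows D.P, Matrix.fromRows_mul, Matrix.fromBlocks_mul_fromRows,
    Matrix.fromRows_inj.eq_iff] at h
  simpa using h

lemma obsProj_map (x : Euc n) :
    D.obsProj (A.toEuclideanLin x) = D.Ao.toEuclideanLin (D.obsProj x) := by
  have h2 := congrArg (fun M : Matrix (Fin no) (Fin n) ℝ => M.toEuclideanLin x)
    D.proj_mul_matrices.1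
  simpa [obsProj] using h2

lemma unobsProj_map (x : Euc n) :
    D.unobsProj (A.toEuclideanLin x)
      = D.A21.toEuclideanLin (D.obsProj x) + D.Au.toEuclideanLin (D.unobsProj x) := by
  have h2 := congrArg (fun M : Matrix (Fin nu) (Fin n) ℝ => M.toEuclideanLin x)
    D.proj_mul_matrices.2
  simpa [obsProj, unobsProj] using h2

lemma output_eq (x : Euc n) : C.toEuclideanLin x = D.Co.toEuclideanLin (D.obsProj x) := by
  have h : C = D.Co * D.P.toRows₁ := by
    have h1 : C = C * D.Pinv * Matrix.fromRows D.P.toRows₁ D.P.toRows₂ := by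
      rw [Matrix.fromRows_toRows, Matrix.mul_assoc, D.Pinv_mul_P, Matrix.mul_one]
    rwa [D.C_eq, Matrix.fromCols_mul_fromRows, Matrix.zero_mul, add_zero] at h1
  have h2 := congrArg (fun M : Matrix (Fin m) (Fin n) ℝ => M.toEuclideanLin x) h
  simpa [obsProj] using h2

/-- The zero block of the decomposition makes the unobservable subspace invariant. -/
lemma map_unobsIncl (b : Euc nu) :
    A.toEuclideanLin (D.unobsIncl b) = D.unobsIncl (D.Au.toEuclideanLin b) := by
  rw [← D.incl_proj (A.toEuclideanLin (D.unobsIncl b)), D.obsProj_map, D.unobsProj_map,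
    D.obsProj_unobsIncl, D.unobsProj_unobsIncl]
  simp

lemma pow_map_unobsIncl (k : ℕ) (b : Euc nu) :
    (A.toEuclideanLin ^ k) (D.unobsIncl b) = D.unobsIncl ((D.Au.toEuclideanLin ^ k) b) := by
  induction k with
  | zero => simp
  | succ k ih => rw [pow_succ', pow_succ', Module.End.mul_apply, Module.End.mul_apply, ih,
      D.map_unobsIncl]

lemma output_unobsIncl (b : Euc nu) : C.toEuclideanLin (D.unobsIncl b) = 0 := by
  rw [D.output_eq, D.obsProj_unobsIncl, map_zero]

/-- Detectability makes the unobservable subsystem stable. -/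
lemma tendsto_pow_unobs (hdet : IsDetectable A C) (b : Euc nu) :
    Filter.Tendsto (fun k : ℕ => (D.Au.toEuclideanLin ^ k) b) Filter.atTop (nhds 0) := by
  have h := hdet (D.unobsIncl b) fun k => by
    rw [Matrix.toLpLin_mul (q := 2), LinearMap.comp_apply, Matrix.toLpLin_pow,
      D.pow_map_unobsIncl, D.output_unobsIncl]
  have h2 := (D.unobsProj.continuous_of_finiteDimensional.tendsto 0).comp h
  rw [map_zero] at h2
  refine h2.congr fun k => ?_
  rw [Function.comp_apply, Matrix.toLpLin_pow, D.pow_map_unobsIncl, D.unobsProj_unobsIncl]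

lemma exists_bound_pow_unobsIncl (hdet : IsDetectable A C) (c : ℝ) :
    ∃ M : ℝ, ∀ (b : Euc nu) (k : ℕ), ‖b‖ ≤ c →
      ‖(A.toEuclideanLin ^ k) (D.unobsIncl b)‖ ≤ M := by
  obtain ⟨M, hM⟩ := LinearMap.exists_bound_of_tendsto_pow _ (D.tendsto_pow_unobs hdet) c
  obtain ⟨K, hK, hi⟩ := D.unobsIncl.exists_norm_le_mul
  refine ⟨K * M, fun b k hb => ?_⟩
  rw [D.pow_map_unobsIncl]
  refine (hi _).trans (mul_le_mul_of_nonneg_left ?_ hK)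
  -- A free orbit is a perturbed orbit with zero defects.
  refine hM (fun k => (D.Au.toEuclideanLin ^ k) b) k hb fun i _ => ?_
  rw [pow_succ', Module.End.mul_apply, sub_self, norm_zero]
  exact (norm_nonneg _).trans hb

/-- For a detectable pair and a horizon not shorter than the observability index, bounded
perturbations, bounded outputs and bounded initial unobservable coordinates imply that the state
at the end of the horizon is bounded, uniformly in the horizon. -/
lemma exists_bound_of_detectable (hdet : IsDetectable A C) (c : ℝ) :
    ∃ M : ℝ, ∀ (e : ℕ → Euc n) (k : ℕ), D.index ≤ k + 1 →
      (∀ i < k, ‖e (i + 1) - A.toEuclideanLin (e i)‖ ≤ c) →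
      (∀ i ≤ k, ‖C.toEuclideanLin (e i)‖ ≤ c) → ‖D.unobsProj (e 0)‖ ≤ c → ‖e k‖ ≤ M := by
  obtain ⟨Ko, hKo, ho⟩ := D.obsProj.exists_norm_le_mul
  obtain ⟨Ku, hKu, hu⟩ := D.unobsProj.exists_norm_le_mul
  obtain ⟨Lo, hLo, hio⟩ := D.obsIncl.exists_norm_le_mul
  obtain ⟨Lu, hLu, hiu⟩ := D.unobsIncl.exists_norm_le_mul
  obtain ⟨K21, hK21, h21⟩ := D.A21.toEuclideanLin.exists_norm_le_mul
  obtain ⟨Mo, hMo⟩ := LinearMap.exists_bound_of_bounded_outputs D.Ao.toEuclideanLin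
    D.Co.toEuclideanLin D.index D.eq_zero_of_outputs_eq_zero (max c (Ko * c))
  -- The coupling through `A21`, at most `K21 * Mo`, counts as a perturbation of the unobservable
  -- recursion.
  obtain ⟨Mu, hMu⟩ := LinearMap.exists_bound_of_tendsto_pow _ (D.tendsto_pow_unobs hdet)
    (max c (Ku * c + K21 * Mo))
  refine ⟨Lo * Mo + Lu * Mu, fun e k hk he hC h0 => ?_⟩
  have hobs : ∀ i ≤ k, ‖D.obsProj (e i)‖ ≤ Mo := by
    refine hMo (fun i => D.obsProj (e i)) k hk (fun i hi => ?_) fun i hi => ?_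
    · rw [← D.obsProj_map, ← map_sub]
      exact ((ho _).trans (mul_le_mul_of_nonneg_left (he i hi) hKo)).trans (le_max_right _ _)
    · rw [← D.output_eq]
      exact (hC i hi).trans (le_max_left _ _)
  have hunobs : ‖D.unobsProj (e k)‖ ≤ Mu := by
    refine hMu (fun i => D.unobsProj (e i)) k (h0.trans (le_max_left _ _)) fun i hi => ?_
    have e1 : D.unobsProj (e (i + 1)) - D.Au.toEuclideanLin (D.unobsProj (e i))
        = D.unobsProj (e (i + 1) - A.toEuclideanLin (e i))
          + D.A21.toEuclideanLin (D.obsProj (e i)) := by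
      rw [map_sub, D.unobsProj_map]; abel
    rw [e1]
    refine ((norm_add_le _ _).trans (add_le_add ?_ ?_)).trans (le_max_right _ _)
    · exact (hu _).trans (mul_le_mul_of_nonneg_left (he i hi) hKu)
    · exact (h21 _).trans (mul_le_mul_of_nonneg_left (hobs i hi.le) hK21)
  rw [← D.incl_proj (e k)]
  exact (norm_add_le _ _).trans (add_le_add
    ((hio _).trans (mul_le_mul_of_nonneg_left (hobs k le_rfl) hLo))
    ((hiu _).trans (mul_le_mul_of_nonneg_left hunobs hLu)))

lemma mem_pullProd_iff {To : Set (Euc no)} {Tu : Set (Euc nu)} {x : Euc n} :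
    x ∈ D.pullProd To Tu ↔ ∃ a ∈ To, ∃ b ∈ Tu, x = D.obsIncl a + D.unobsIncl b := by
  simp only [pullProd, obsIncl_add_unobsIncl, Set.mem_ofPred_eq]

lemma unobsProj_mem_of_mem_pullProd {To : Set (Euc no)} {Tu : Set (Euc nu)} {x : Euc n}
    (hx : x ∈ D.pullProd To Tu) : D.unobsProj x ∈ Tu := by
  obtain ⟨a, -, b, hb, rfl⟩ := D.mem_pullProd_iff.1 hx
  have h2 := congrArg (fun M : Matrix (Fin nu) (Fin no) ℝ => M.toEuclideanLin a)
    D.proj_incl_matrices.2.2.1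
  have h3 : D.unobsProj (D.obsIncl a) = 0 := by simpa [obsIncl, unobsProj] using h2
  rwa [map_add, h3, D.unobsProj_unobsIncl, zero_add]

lemma isBounded_projUnobs {T : Set (Euc n)} (hT : Bornology.IsBounded T) :
    Bornology.IsBounded (D.projUnobs T) :=
  D.unobsProj.isBounded_image hT

lemma isBounded_pullProd {To : Set (Euc no)} {Tu : Set (Euc nu)} (ho : Bornology.IsBounded To)
    (hu : Bornology.IsBounded Tu) : Bornology.IsBounded (D.pullProd To Tu) := by
  refine ((D.obsIncl.isBounded_image ho).add (D.unobsIncl.isBounded_image hu)).subset ?_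
  intro x hx
  obtain ⟨a, ha, b, hb, rfl⟩ := D.mem_pullProd_iff.1 hx
  exact Set.add_mem_add (Set.mem_image_of_mem _ ha) (Set.mem_image_of_mem _ hb)

end ObsDecomposition

/-! ### Trajectories compatible with the measurements -/

namespace UncertainSystem

variable {Ω : Type*} {n p m no nu : ℕ} (S : UncertainSystem Ω n p m)

/-- `z` is, up to time `k`, a state trajectory compatible with the noise ranges and with the
measurements `y`. -/
def IsTrajectory (y : ℕ → Euc m) (k : ℕ) (z : ℕ → Euc n) : Prop :=
  (∀ i < k, z (i + 1) - S.A.toEuclideanLin (z i) ∈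
    S.B.toEuclideanLin '' Set.range (S.w i)) ∧ ∀ i ≤ k, z i ∈ S.measSet y i

variable {S} {y : ℕ → Euc m}

/-- Unrolling the recursion reduces statements about set estimates to statements about single
trajectories. Each noise value is chosen from its own range, with no common `ω` required. -/
lemma mem_filteringMap_iff {T : Set (Euc n)} {k : ℕ} {x : Euc n} :
    x ∈ S.filteringMap y k T ↔ ∃ z, z 0 ∈ T ∧ z k = x ∧ S.IsTrajectory y k z := by
  induction k generalizing x with
  | zero =>
    constructor
    · rintro ⟨h1, h2⟩
      refine ⟨fun _ => x, h2, rfl, fun i hi => absurd hi i.not_lt_zero, fun i hi => ?_⟩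
      rwa [Nat.le_zero.1 hi]
    · rintro ⟨z, h0, rfl, -, h⟩
      exact ⟨h 0 le_rfl, h0⟩
  | succ k ih =>
    constructor
    · rintro ⟨h1, a, ⟨x', hx', rfl⟩, b, hb, rfl⟩
      obtain ⟨z, h0, rfl, hz, hm⟩ := ih.1 hx'
      set x := S.A.toEuclideanLin (z k) + b with hx
      refine ⟨fun i => if i ≤ k then z i else x, by simpa using h0, by simp [hx],
        fun i hi => ?_, fun i hi => ?_⟩
      · rcases (Nat.lt_succ_iff.1 hi).eq_or_lt with rfl | h
        · simpa [hx] using hb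
        · simpa [h.le, Nat.succ_le_of_lt h] using hz i h
      · rcases hi.eq_or_lt with rfl | h
        · simpa using h1
        · simpa [Nat.lt_succ_iff.1 h] using hm i (Nat.lt_succ_iff.1 h)
    · rintro ⟨z, h0, rfl, hz, hm⟩
      refine ⟨hm _ le_rfl, S.A.toEuclideanLin (z k), Set.mem_image_of_mem _
        (ih.2 ⟨z, h0, rfl, fun i hi => hz i (by omega), fun i hi => hm i (by omega)⟩), _,
        hz k k.lt_succ_self, by simp⟩

lemma isTrajectory_state {ω : Ω} {k : ℕ} (h : ∀ i ≤ k, S.meas i ω = y i) :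
    S.IsTrajectory y k fun i => S.state i ω := by
  refine ⟨fun i _ => ⟨S.w i ω, ⟨ω, rfl⟩, ?_⟩, fun i hi => ⟨S.v i ω, ⟨ω, rfl⟩, (h i hi).symm⟩⟩
  simp [state]

/-- A free orbit with zero output alters neither the process defects nor the outputs. -/
lemma IsTrajectory.add_unobservable {k : ℕ} {z : ℕ → Euc n} (h : S.IsTrajectory y k z)
    {d : Euc n} (hd : ∀ i : ℕ, S.C.toEuclideanLin ((S.A.toEuclideanLin ^ i) d) = 0) :
    S.IsTrajectory y k fun i => z i + (S.A.toEuclideanLin ^ i) d := by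
  refine ⟨fun i hi => ?_, fun i hi => ?_⟩
  · have := h.1 i hi
    dsimp only
    rwa [map_add, pow_succ', Module.End.mul_apply, add_sub_add_right_eq_sub]
  · obtain ⟨u, hu, e⟩ := h.2 i hi
    exact ⟨u, hu, by rw [map_add, hd, add_zero, e]⟩

/-- Subtraction cancels the measurements and leaves differences of noise values. Only diameters
enter, so the noise ranges may drift with `k`. -/
lemma exists_trajectory_difference_bound {dw dv : ℝ} (hdw : 0 < dw) (hdv : 0 < dv)
    (hw : ∀ k, Metric.ediam (Set.range (S.w k)) ≤ ENNReal.ofReal dw)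
    (hv : ∀ k, Metric.ediam (Set.range (S.v k)) ≤ ENNReal.ofReal dv) :
    ∃ c : ℝ, ∀ (y : ℕ → Euc m) (k : ℕ) (z z' : ℕ → Euc n), S.IsTrajectory y k z →
      S.IsTrajectory y k z' →
      (∀ i < k, ‖(z (i + 1) - z' (i + 1)) - S.A.toEuclideanLin (z i - z' i)‖ ≤ c) ∧
        ∀ i ≤ k, ‖S.C.toEuclideanLin (z i - z' i)‖ ≤ c := by
  obtain ⟨K, hK, hB⟩ := S.B.toEuclideanLin.exists_norm_le_mul
  have dist_le {d : ℕ} {s : Set (Euc d)} {r : ℝ} (hr : 0 < r)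
      (hs : Metric.ediam s ≤ ENNReal.ofReal r) {a b : Euc d} (ha : a ∈ s) (hb : b ∈ s) :
      ‖a - b‖ ≤ r := by
    rw [← dist_eq_norm, ← ENNReal.ofReal_le_ofReal_iff hr.le, ← edist_dist]
    exact (Metric.edist_le_ediam_of_mem ha hb).trans hs
  refine ⟨max (K * dw) dv, fun y k z z' h h' => ⟨fun i hi => ?_, fun i hi => ?_⟩⟩
  · obtain ⟨a, ha, e⟩ := h.1 i hi
    obtain ⟨a', ha', e'⟩ := h'.1 i hi
    have : (z (i + 1) - z' (i + 1)) - S.A.toEuclideanLin (z i - z' i)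
        = S.B.toEuclideanLin (a - a') := by
      rw [map_sub, map_sub, e, e']; abel
    rw [this]
    exact ((hB _).trans (mul_le_mul_of_nonneg_left (dist_le hdw (hw i) ha ha') hK)).trans
      (le_max_left _ _)
  · obtain ⟨u, hu, e⟩ := h.2 i hi
    obtain ⟨u', hu', e'⟩ := h'.2 i hi
    have : S.C.toEuclideanLin (z i - z' i) = u' - u := by
      rw [map_sub, sub_eq_sub_iff_add_eq_add, ← e, add_comm u', ← e']
    rw [this]
    exact (dist_le hdv (hv i) hu' hu).trans (le_max_right _ _)

lemma isBounded_range_of_ediam_le {α : Type*} {d : ℕ} {f : α → Euc d} {r : ℝ}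
    (h : Metric.ediam (Set.range f) ≤ ENNReal.ofReal r) : Bornology.IsBounded (Set.range f) :=
  Metric.isBounded_iff_ediam_ne_top.2 (h.trans_lt ENNReal.ofReal_lt_top).ne

lemma isBounded_predict {k : ℕ} (hw : Bornology.IsBounded (Set.range (S.w k)))
    {T : Set (Euc n)} (hT : Bornology.IsBounded T) :
    Bornology.IsBounded
      (S.A.toEuclideanLin '' T + S.B.toEuclideanLin '' Set.range (S.w k)) :=
  (S.A.toEuclideanLin.isBounded_image hT).add (S.B.toEuclideanLin.isBounded_image hw)

lemma isBounded_predUpdate {k : ℕ} (hw : Bornology.IsBounded (Set.range (S.w k)))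
    {T : Set (Euc n)} (hT : Bornology.IsBounded T) :
    Bornology.IsBounded (S.predUpdate y k T) :=
  (isBounded_predict hw hT).subset Set.inter_subset_right

lemma isBounded_filteringMap (hw : ∀ k, Bornology.IsBounded (Set.range (S.w k)))
    {T : Set (Euc n)} (hT : Bornology.IsBounded T) (k : ℕ) :
    Bornology.IsBounded (S.filteringMap y k T) := by
  induction k with
  | zero => exact hT.subset Set.inter_subset_right
  | succ k ih => exact isBounded_predUpdate (hw k) ih

lemma isBounded_condRange (hw : ∀ k, Bornology.IsBounded (Set.range (S.w k)))
    (hx0 : Bornology.IsBounded (Set.range S.x0)) (k : ℕ) :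
    Bornology.IsBounded (S.condRange y k) := by
  have h : Bornology.IsBounded (Set.range (S.state k)) := by
    induction k with
    | zero => exact hx0
    | succ k ih =>
      refine (isBounded_predict (hw k) ih).subset ?_
      rintro _ ⟨ω, rfl⟩
      exact Set.add_mem_add ⟨_, ⟨ω, rfl⟩, rfl⟩ ⟨_, ⟨ω, rfl⟩, rfl⟩
  refine h.subset ?_
  rintro _ ⟨ω, -, rfl⟩
  exact ⟨ω, rfl⟩

lemma condRange_nonempty (hy : S.IsObserved y) (k : ℕ) : (S.condRange y k).Nonempty := by
  obtain ⟨ω, h⟩ := hy k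
  exact ⟨_, ω, h, rfl⟩

/-! ### Resets, runs and the estimation gap -/

variable (D : ObsDecomposition S.A S.C no nu)

/-- The unobservable coordinates of the initial state can be replaced without affecting the
compatibility with the measurements. -/
lemma add_mem_filteringMap_pullProd {ω : Ω} {k : ℕ} (h : ∀ i ≤ k, S.meas i ω = y i)
    {To : Set (Euc no)} (ho : D.obsProj (S.x0 ω) ∈ To) {Tu : Set (Euc nu)} {b : Euc nu}
    (hb : b ∈ Tu) :
    S.state k ω + (S.A.toEuclideanLin ^ k) (D.unobsIncl (b - D.unobsProj (S.x0 ω)))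
      ∈ S.filteringMap y k (D.pullProd To Tu) := by
  refine mem_filteringMap_iff.2 ⟨_, ?_, rfl, (isTrajectory_state h).add_unobservable fun i => by
    rw [D.pow_map_unobsIncl, D.output_unobsIncl]⟩
  refine D.mem_pullProd_iff.2 ⟨_, ho, b, hb, ?_⟩
  change S.x0 ω + D.unobsIncl (b - D.unobsProj (S.x0 ω)) = _
  nth_rewrite 1 [← D.incl_proj (S.x0 ω)]
  rw [map_sub]
  abel

lemma projUnobs_nonempty {X0 : Set (Euc n)} (hX0 : X0.Nonempty) : (D.projUnobs X0).Nonempty :=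
  hX0.image _

lemma exists_reset (hw : ∀ k, Bornology.IsBounded (Set.range (S.w k)))
    {X0 : Set (Euc n)} (hX0 : X0.Nonempty) (hX0b : Bornology.IsBounded X0)
    (hy : S.IsObserved y) (k : ℕ) :
    ∃ To : Set (Euc no), (S.filteringMap y k (D.pullProd To (D.projUnobs X0))).Nonempty ∧
      Bornology.IsBounded (S.filteringMap y k (D.pullProd To (D.projUnobs X0))) := by
  obtain ⟨ω, h⟩ := hy k
  obtain ⟨b, hb⟩ := projUnobs_nonempty D hX0
  -- The observable coordinates of one compatible true initial state suffice, and a singleton keeps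
  -- the estimate bounded.
  exact ⟨{D.obsProj (S.x0 ω)}, ⟨_, add_mem_filteringMap_pullProd D h (Set.mem_singleton _) hb⟩,
    isBounded_filteringMap hw
      (D.isBounded_pullProd Bornology.isBounded_singleton (D.isBounded_projUnobs hX0b)) k⟩

lemma exists_isOITRun (hw : ∀ k, Bornology.IsBounded (Set.range (S.w k))) (mode : EarlyMode)
    {X0 : Set (Euc n)} (hX0 : X0.Nonempty) (hX0b : Bornology.IsBounded X0)
    (hy : S.IsObserved y) : ∃ Z, S.IsOITRun D mode X0 y Z := by
  classical
  choose To hne hbd using exists_reset D hw hX0 hX0b hy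
  let R : ℕ → Set (Euc n) := fun k => S.filteringMap y k (D.pullProd (To k) (D.projUnobs X0))
  let step : ℕ → Set (Euc n) → Set (Euc n) := fun k E =>
    if D.index ≤ k + 1 then S.filteringMap y k (D.pullProd Set.univ (D.projUnobs X0))
    else if E.Nonempty then E else R k
  -- In mode `fromPrevious` the classical estimate depends on the preceding, possibly reset, value
  -- of `Z`, so `Z` is built recursively.
  obtain ⟨Z, hZ⟩ : ∃ Z : ℕ → Set (Euc n), ∀ k, Z k = step k (S.classicalEstimate y X0 Z mode k) := by
    cases mode with
    | fromInitial => exact ⟨fun k => step k (S.filteringMap y k X0), fun k => rfl⟩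
    | fromPrevious =>
      refine ⟨fun k => Nat.rec (step 0 (S.measSet y 0 ∩ X0))
        (fun k E => step (k + 1) (S.predUpdate y k E)) k, fun k => ?_⟩
      cases k <;> rfl
  refine ⟨Z, fun k hk h => ?_, fun k hk h => ?_, fun k hk => ?_⟩
  · rw [hZ k]
    simp only [step, if_neg (not_le.2 hk), if_pos h]
  · have e : Z k = R k := by
      rw [hZ k, h]
      simp only [step, if_neg (not_le.2 hk), if_neg Set.not_nonempty_empty]
    rw [e]
    exact ⟨⟨To k, rfl⟩, hne k, hbd k⟩
  · rw [hZ k]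
    simp only [step, if_pos hk]

variable {D} {mode : EarlyMode} {X0 : Set (Euc n)} {Z : ℕ → Set (Euc n)}

lemma IsOITRun.nonempty (hZ : S.IsOITRun D mode X0 y Z) (hX0 : X0.Nonempty)
    (hy : S.IsObserved y) (k : ℕ) : (Z k).Nonempty := by
  rcases lt_or_ge (k + 1) D.index with hk | hk
  · rcases Set.eq_empty_or_nonempty (S.classicalEstimate y X0 Z mode k) with h | h
    · exact (hZ.early_reset k hk h).2.1
    · rwa [hZ.early_keep k hk h]
  · obtain ⟨ω, h⟩ := hy k
    obtain ⟨b, hb⟩ := projUnobs_nonempty D hX0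
    rw [hZ.late k hk]
    exact ⟨_, add_mem_filteringMap_pullProd D h (Set.mem_univ _) hb⟩

/-- Induction serves mode `fromPrevious`, where boundedness is inherited from the preceding
estimate. -/
lemma IsOITRun.isBounded_early (hZ : S.IsOITRun D mode X0 y Z)
    (hw : ∀ k, Bornology.IsBounded (Set.range (S.w k))) (hX0b : Bornology.IsBounded X0) (k : ℕ)
    (hk : k + 1 < D.index) : Bornology.IsBounded (Z k) := by
  induction k with
  | zero =>
    rcases Set.eq_empty_or_nonempty (S.classicalEstimate y X0 Z mode 0) with h | h
    · exact (hZ.early_reset 0 hk h).2.2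
    · rw [hZ.early_keep 0 hk h]
      cases mode <;> exact hX0b.subset Set.inter_subset_right
  | succ k ih =>
    rcases Set.eq_empty_or_nonempty (S.classicalEstimate y X0 Z mode (k + 1)) with h | h
    · exact (hZ.early_reset _ hk h).2.2
    · rw [hZ.early_keep _ hk h]
      cases mode with
      | fromInitial => exact isBounded_filteringMap hw hX0b _
      | fromPrevious => exact isBounded_predUpdate (hw k) (ih (by omega))

/-- From the time `μ_o - 1` on, the estimation gap is uniformly bounded. -/
lemma exists_late_gap_bound (hdet : IsDetectable S.A S.C)
    (hx0 : Bornology.IsBounded (Set.range S.x0)) {dw dv : ℝ} (hdw : 0 < dw) (hdv : 0 < dv)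
    (hw : ∀ k, Metric.ediam (Set.range (S.w k)) ≤ ENNReal.ofReal dw)
    (hv : ∀ k, Metric.ediam (Set.range (S.v k)) ≤ ENNReal.ofReal dv)
    (D : ObsDecomposition S.A S.C no nu) (hX0 : X0.Nonempty) (hX0b : Bornology.IsBounded X0)
    (hy : S.IsObserved y) :
    ∃ d : ℝ, ∀ k, D.index ≤ k + 1 →
      Metric.hausdorffEDist (S.filteringMap y k (D.pullProd Set.univ (D.projUnobs X0)))
        (S.condRange y k) ≤ ENNReal.ofReal d := by
  obtain ⟨c, hc⟩ := exists_trajectory_difference_bound hdw hdv hw hv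
  -- The initial mismatch is bounded in the unobservable coordinates only; the observable ones range
  -- over all of `ℝ^no`.
  obtain ⟨r, hr⟩ : ∃ r : ℝ, ∀ b ∈ D.projUnobs X0, ∀ ω, ‖b - D.unobsProj (S.x0 ω)‖ ≤ r := by
    obtain ⟨r1, h1⟩ := (D.isBounded_projUnobs hX0b).exists_norm_le
    obtain ⟨r2, h2⟩ := (D.unobsProj.isBounded_image hx0).exists_norm_le
    exact ⟨r1 + r2, fun b hb ω => (norm_sub_le _ _).trans
      (add_le_add (h1 b hb) (h2 _ ⟨_, ⟨ω, rfl⟩, rfl⟩))⟩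
  obtain ⟨M, hM⟩ := D.exists_bound_of_detectable hdet (max c r)
  obtain ⟨M', hM'⟩ := D.exists_bound_pow_unobsIncl hdet r
  refine ⟨max M M', fun k hk => Metric.hausdorffEDist_le_of_mem_edist ?_ ?_⟩
  -- Any compatible `ω` serves: its trajectory differs from `z` by a sequence with bounded defects
  -- and outputs.
  · intro x hx
    obtain ⟨z, h0, rfl, hz⟩ := mem_filteringMap_iff.1 hx
    obtain ⟨ω, h⟩ := hy k
    refine ⟨S.state k ω, ⟨ω, h, rfl⟩, ?_⟩
    rw [edist_dist, dist_eq_norm]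
    refine ENNReal.ofReal_le_ofReal (le_trans ?_ (le_max_left _ _))
    obtain ⟨h1, h2⟩ := hc y k z _ hz (isTrajectory_state h)
    refine hM (fun i => z i - S.state i ω) k hk (fun i hi => (h1 i hi).trans (le_max_left _ _))
      (fun i hi => (h2 i hi).trans (le_max_left _ _)) ?_
    rw [map_sub]
    exact (hr _ (D.unobsProj_mem_of_mem_pullProd h0) ω).trans (le_max_right _ _)
  -- The nearby estimate is the true state shifted along the unobservable subspace.
  · rintro _ ⟨ω, h, rfl⟩
    obtain ⟨b, hb⟩ := projUnobs_nonempty D hX0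
    refine ⟨_, add_mem_filteringMap_pullProd D h (Set.mem_univ _) hb, ?_⟩
    rw [edist_comm, edist_dist, dist_eq_norm, add_sub_cancel_left]
    exact ENNReal.ofReal_le_ofReal ((hM' _ _ (hr b hb ω)).trans (le_max_right _ _))

end UncertainSystem

/-! ### Stability of the filter -/

theorem theorem3 {Ω : Type*} {n p m no nu : ℕ} (S : UncertainSystem Ω n p m)
    (hA : IsUnit S.A.det)
    (hx0 : Bornology.IsBounded (Set.range S.x0))
    (dw dv : ℝ) (hdw : 0 < dw) (hdv : 0 < dv)
    (hw : ∀ k, Metric.ediam (Set.range (S.w k)) ≤ ENNReal.ofReal dw)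
    (hv : ∀ k, Metric.ediam (Set.range (S.v k)) ≤ ENNReal.ofReal dv)
    (hdet : IsDetectable S.A S.C)
    (D : ObsDecomposition S.A S.C no nu)
    (mode : EarlyMode)
    (X0 : Set (Euc n)) (hX0 : X0.Nonempty) (hX0b : Bornology.IsBounded X0)
    (y : ℕ → Euc m) (hy : S.IsObserved y) :
    (∃ Z, S.IsOITRun D mode X0 y Z) ∧
      ∀ Z, S.IsOITRun D mode X0 y Z → S.IsStable y Z := by
  have hwb := fun k => UncertainSystem.isBounded_range_of_ediam_le (hw k)
  refine ⟨UncertainSystem.exists_isOITRun D hwb mode hX0 hX0b hy, fun Z hZ => ?_⟩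
  have hne := hZ.nonempty hX0 hy
  refine ⟨hne, ?_⟩
  obtain ⟨d, hd⟩ := UncertainSystem.exists_late_gap_bound hdet hx0 hdw hdv hw hv D hX0 hX0b hy
  -- `toReal` would send an infinite distance to `0`; `g` is converted back only at early times,
  -- where the distance is finite.
  let g : ℕ → ℝ := fun k => (Metric.hausdorffEDist (Z k) (S.condRange y k)).toReal
  have hsum : 0 ≤ ∑ i ∈ Finset.range D.index, g i :=
    Finset.sum_nonneg fun i _ => ENNReal.toReal_nonneg
  -- The sum dominates each early gap, `|d|` the late ones, and `1` ensures strict positivity.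
  refine ⟨|d| + ∑ i ∈ Finset.range D.index, g i + 1, by positivity, fun k => ?_⟩
  rcases lt_or_ge (k + 1) D.index with hk | hk
  · have hfin := Metric.hausdorffEDist_ne_top_of_nonempty_of_bounded (hne k)
      (UncertainSystem.condRange_nonempty hy k) (hZ.isBounded_early hwb hX0b k hk)
      (UncertainSystem.isBounded_condRange hwb hx0 k)
    rw [← ENNReal.ofReal_toReal hfin]
    refine ENNReal.ofReal_le_ofReal ?_
    have h1 := Finset.single_le_sum (f := g) (fun i _ => ENNReal.toReal_nonneg)
      (Finset.mem_range.2 (by omega : k < D.index))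
    have h2 := abs_nonneg d
    change g k ≤ _
    linarith
  · rw [hZ.late k hk]
    refine (hd k hk).trans (ENNReal.ofReal_le_ofReal ?_)
    have := le_abs_self d
    linarith
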